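/- For a domain (nonempty connected open set) $G\subsetneq\mathbb R^n$ and $x\in G$ let $\delta_G(x)$ be the Euclidean distance from $x$ to $\partial G$, and let $$k_G(x,y)=\inf_\gamma\int_\gamma\frac{|dz|}{\delta_G(z)}\qquad(x,y\in G)$$ be the quasihyperbolic distance, where the infimum is over all rectifiable curves $\gamma$ joining $x$ and $y$ in $G$. For a strictly increasing homeomorphism $\varphi:[0,\infty)\to[0,\infty)$ with $\varphi(0)=0$, the domain $G$ is called $\varphi$-uniform if $$k_G(x,y)\le\varphi\left(\frac{|x-y|}{\min\{\delta_G(x),\delta_G(y)\}}\right)\qquad\text{for all }x,y\in G.$$ **Proposition.** There is a bounded Jordan domain $D\subsetneq\mathbb R^2$ (a bounded domain whose boundary is a Jordan curve) such that $D$ is $\varphi$-uniform for some such $\varphi$, while its exterior $\mathbb R^2\setminus\overline D$, which is again a domain, is not $\psi$-uniform for any such $\psi$. -/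

import Mathlib

open Set MeasureTheory
open scoped NNReal ENNReal

namespace PhiUniform

/-- A domain: a nonempty connected open set. -/
structure IsOpenDomain {n : ℕ} (G : Set (EuclideanSpace ℝ (Fin n))) : Prop where
  isOpen : IsOpen G
  isConnected : IsConnected G

/-- `δ_G(x)`, the Euclidean distance from `x` to the boundary of `G`. -/
noncomputable def bdryDist {n : ℕ} (G : Set (EuclideanSpace ℝ (Fin n)))
    (x : EuclideanSpace ℝ (Fin n)) : ℝ≥0 :=
  Metric.infNndist x (frontier G)

/-- Rectifiable curves `γ : [0,1] → G` from `x` to `y` (only the values on `[0,1]` matter). -/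
structure IsRectifiableCurve {n : ℕ} (G : Set (EuclideanSpace ℝ (Fin n)))
    (x y : EuclideanSpace ℝ (Fin n)) (γ : ℝ → EuclideanSpace ℝ (Fin n)) : Prop where
  continuousOn : ContinuousOn γ (Icc 0 1)
  mapsTo : MapsTo γ (Icc 0 1) G
  source : γ 0 = x
  target : γ 1 = y
  rectifiable : eVariationOn γ (Icc 0 1) ≠ ∞

/-- The Euclidean length of a curve `γ : [0,1] → ℝⁿ`; used for rectifiable curves only. -/
noncomputable def curveLength {n : ℕ} (γ : ℝ → EuclideanSpace ℝ (Fin n)) : ℝ :=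
  (eVariationOn γ (Icc 0 1)).toReal

/-- The line integral `∫_γ ρ |dz|` of a nonnegative function along a rectifiable curve
`γ : [0,1] → ℝⁿ`, computed in the arc length parametrization of `γ`. -/
noncomputable def arcIntegral {n : ℕ} (ρ : EuclideanSpace ℝ (Fin n) → ℝ≥0∞)
    (γ : ℝ → EuclideanSpace ℝ (Fin n)) : ℝ≥0∞ :=
  ∫⁻ s in Icc 0 (curveLength γ), ρ (naturalParameterization γ (Icc 0 1) 0 s)

/-- The quasihyperbolic length `∫_γ |dz| / δ_G(z)`. -/
noncomputable def qhLength {n : ℕ} (G : Set (EuclideanSpace ℝ (Fin n)))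
    (γ : ℝ → EuclideanSpace ℝ (Fin n)) : ℝ≥0∞ :=
  arcIntegral (fun z => (bdryDist G z : ℝ≥0∞)⁻¹) γ

/-- The quasihyperbolic distance `k_G(x,y)`. -/
noncomputable def qhDist {n : ℕ} (G : Set (EuclideanSpace ℝ (Fin n)))
    (x y : EuclideanSpace ℝ (Fin n)) : ℝ≥0∞ :=
  ⨅ (γ : ℝ → EuclideanSpace ℝ (Fin n)) (_ : IsRectifiableCurve G x y γ), qhLength G γ

/-- `G` is a proper subdomain of `ℝⁿ` with `k_G(x,y) ≤ φ(|x-y| / min(δ_G(x), δ_G(y)))` for all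
`x, y ∈ G`, where `φ` is a strictly increasing homeomorphism of `[0,∞)` fixing `0`. -/
structure IsPhiUniform {n : ℕ} (φ : ℝ≥0 ≃ₜ ℝ≥0) (G : Set (EuclideanSpace ℝ (Fin n))) :
    Prop where
  strictMono : StrictMono φ
  map_zero : φ 0 = 0
  isOpenDomain : IsOpenDomain G
  ne_univ : G ≠ univ
  qhDist_le : ∀ x ∈ G, ∀ y ∈ G,
    qhDist G x y ≤ (φ (nndist x y / min (bdryDist G x) (bdryDist G y)) : ℝ≥0∞)

/-- A Jordan curve: a homeomorphic image of the unit circle. -/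
def IsJordanCurve (J : Set (EuclideanSpace ℝ (Fin 2))) : Prop :=
  ∃ c : Circle → EuclideanSpace ℝ (Fin 2), Continuous c ∧ Function.Injective c ∧ range c = J

/-- A bounded Jordan domain in the plane: a bounded domain whose boundary is a Jordan curve. -/
structure IsBoundedJordanDomain (D : Set (EuclideanSpace ℝ (Fin 2))) : Prop where
  isOpenDomain : IsOpenDomain D
  isBounded : Bornology.IsBounded D
  frontier_jordan : IsJordanCurve (frontier D)

end PhiUniform

/-! The domain is the outward quadratic cusp `|y| < x²`, `0 < x < 1`.

Inside, the boundary distance is comparable, up to the factor 3, to `h = min (x² - |y|) (1 - x)`. In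
the coordinates `(x, y / x²)`, with second coordinate `τ`, the set `h ≥ m` becomes `|τ| ≤ 1 - m
x⁻²`, `x ≤ 1 - m`, which is convex because `x⁻²` is convex. A segment in these coordinates therefore
never comes closer to the boundary, up to a constant, than its endpoints (`cuspCurve_mem`), and its
image has length at most `6 |a - b|` (`dist_cuspCurve_le`). Hence `k ≤ 18 |a - b| / min δ`.

Outside, `(t, ±2t²)` lie `4t²` apart at distance at least `t² / 3` from the boundary, so the ratio
fed to `ψ` stays below 12. A curve joining them must go around the tip or the far end, so it moves
at least `t` away from a point that is only `t²` from the boundary; this costs at least `log (1 /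
t)`, which is unbounded. -/

namespace PhiUniform

/-! ### Bounds for quasihyperbolic length along rectifiable curves -/

section Curves

variable {n : ℕ} {G : Set (EuclideanSpace ℝ (Fin n))} {x y : EuclideanSpace ℝ (Fin n)}
  {γ : ℝ → EuclideanSpace ℝ (Fin n)}

/-- Every arc length parameter is attained on a rectifiable curve. -/
theorem IsRectifiableCurve.exists_naturalParameterization_eq (hγ : IsRectifiableCurve G x y γ)
    {s : ℝ} (hs : s ∈ Icc 0 (curveLength γ)) :
    ∃ u ∈ Icc (0 : ℝ) 1, (eVariationOn γ (Icc 0 u)).toReal = s ∧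
      naturalParameterization γ (Icc 0 1) 0 s = γ u := by
  have hbv : BoundedVariationOn γ (Icc 0 1) := hγ.rectifiable
  have key : ∀ u ∈ Icc (0 : ℝ) 1,
      variationOnFromTo γ (Icc 0 1) 0 u = (eVariationOn γ (Icc 0 u)).toReal := by
    intro u hu
    rw [variationOnFromTo.eq_of_le _ _ hu.1, inter_eq_right.2 (Icc_subset_Icc_right hu.2)]
  have hcont : ContinuousOn (variationOnFromTo γ (Icc 0 1) 0) (Icc 0 1) := by
    -- At a point of continuity the variation over shrinking one-sided intervals tends to 0, so arc
    -- length is continuous.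
    intro u hu
    have h0 : variationOnFromTo γ (Icc 0 1) u u = 0 := variationOnFromTo.self _ _ _
    have hadd : ∀ v ∈ Icc (0 : ℝ) 1, variationOnFromTo γ (Icc 0 1) 0 u
        + variationOnFromTo γ (Icc 0 1) u v = variationOnFromTo γ (Icc 0 1) 0 v := fun v hv =>
      variationOnFromTo.add hbv.locallyBoundedVariationOn (by simp) hu hv
    have hr := hbv.tendsto_eVariationOn_Icc_zero_right u (hγ.continuousOn.continuousWithinAt hu |>.mono
      inter_subset_left)
    have hl := hbv.tendsto_eVariationOn_Icc_zero_left (x := u) (hγ.continuousOn.continuousWithinAt hu |>.mono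
      inter_subset_left)
    have hr' := (ENNReal.tendsto_toReal ENNReal.zero_ne_top).comp hr
    have hl' := (ENNReal.tendsto_toReal ENNReal.zero_ne_top).comp hl
    -- On either side of `u` one of the two variations vanishes, so their difference is the signed
    -- increment of arc length.
    have hsum := (tendsto_const_nhds (x := variationOnFromTo γ (Icc 0 1) 0 u)).add (hr'.sub hl')
    simp only [ENNReal.toReal_zero, sub_zero, add_zero] at hsum
    refine hsum.congr' ?_
    filter_upwards [self_mem_nhdsWithin] with v hv
    rw [← hadd v hv]
    congr 1
    have hz : ∀ a b : ℝ, b ≤ a → (eVariationOn γ (Icc 0 1 ∩ Icc a b)) = 0 := fun a b hab =>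
      eVariationOn.subsingleton _ (by
        intro p hp q hq
        have := hp.2.1; have := hp.2.2; have := hq.2.1; have := hq.2.2
        linarith)
    rcases le_total u v with huv | huv
    · simp [variationOnFromTo.eq_of_le _ _ huv, hz v u huv]
    · simp [variationOnFromTo.eq_of_ge _ _ huv, hz u v huv]
  have hs' : s ∈ Icc (variationOnFromTo γ (Icc 0 1) 0 0) (variationOnFromTo γ (Icc 0 1) 0 1) := by
    rw [key 1 (by simp), variationOnFromTo.self]
    exact hs
  obtain ⟨u, hu, hus⟩ := intermediate_value_Icc zero_le_one hcont hs'
  refine ⟨u, hu, by rw [← key u hu, hus], ?_⟩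
  have := edist_naturalParameterization_eq_zero hbv.locallyBoundedVariationOn
    (a := 0) (by simp) hu
  rw [hus] at this
  exact edist_eq_zero.1 this

theorem IsRectifiableCurve.qhLength_le (hγ : IsRectifiableCurve G x y γ) {m : ℝ≥0∞}
    (hm : ∀ u ∈ Icc (0 : ℝ) 1, m ≤ bdryDist G (γ u)) :
    qhLength G γ ≤ m⁻¹ * eVariationOn γ (Icc 0 1) := by
  calc qhLength G γ ≤ ∫⁻ _ in Icc 0 (curveLength γ), m⁻¹ := by
        refine setLIntegral_mono' measurableSet_Icc fun s hs => ?_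
        obtain ⟨u, hu, -, h⟩ := hγ.exists_naturalParameterization_eq hs
        rw [h]
        exact ENNReal.inv_le_inv.2 (hm u hu)
    _ = m⁻¹ * eVariationOn γ (Icc 0 1) := by
        rw [setLIntegral_const, Real.volume_Icc, sub_zero, curveLength,
          ENNReal.ofReal_toReal hγ.rectifiable]

theorem lintegral_inv_add_eq_log {d L : ℝ} (hd : 0 < d) (hL : 0 ≤ L) :
    ∫⁻ s in Icc 0 L, ENNReal.ofReal (d + s)⁻¹ = ENNReal.ofReal (Real.log ((d + L) / d)) := by
  have hint : IntervalIntegrable (fun s : ℝ => (d + s)⁻¹) volume 0 L := by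
    refine ContinuousOn.intervalIntegrable ?_
    rw [uIcc_of_le hL]
    refine ContinuousOn.inv₀ (by fun_prop) fun s hs => ?_
    have := hs.1
    positivity
  rw [← ofReal_integral_eq_lintegral_ofReal
    ((intervalIntegrable_iff_integrableOn_Icc_of_le hL).1 hint)]
  · rw [integral_Icc_eq_integral_Ioc, ← intervalIntegral.integral_of_le hL,
      intervalIntegral.integral_comp_add_left (fun s => s⁻¹) d, add_zero,
      integral_inv_of_pos hd (by positivity)]
  · refine (ae_restrict_iff' measurableSet_Icc).2 (Filter.Eventually.of_forall fun s hs => ?_)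
    have := hs.1
    simp only [Pi.zero_apply]
    positivity

/-- A curve starting at distance `d` from a boundary point and moving at least `r` away from its
starting point has quasihyperbolic length at least `log ((d + r) / d)`. -/
theorem IsRectifiableCurve.log_le_qhLength (hγ : IsRectifiableCurve G x y γ)
    {p : EuclideanSpace ℝ (Fin n)} (hp : p ∈ frontier G) (hxp : 0 < dist x p)
    {u r : ℝ} (hu : u ∈ Icc (0 : ℝ) 1) (hr : 0 ≤ r) (hur : r ≤ dist x (γ u)) :
    ENNReal.ofReal (Real.log ((dist x p + r) / dist x p)) ≤ qhLength G γ := by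
  have hrL : r ≤ curveLength γ := by
    refine hur.trans ?_
    rw [← hγ.source]
    exact BoundedVariationOn.dist_le hγ.rectifiable (by simp) hu
  rw [← lintegral_inv_add_eq_log hxp hr]
  calc _ ≤ ∫⁻ s in Icc 0 r, ((bdryDist G (naturalParameterization γ (Icc 0 1) 0 s) : ℝ≥0∞)⁻¹) := by
        refine setLIntegral_mono' measurableSet_Icc fun s hs => ?_
        obtain ⟨v, hv, hvs, h⟩ := hγ.exists_naturalParameterization_eq ⟨hs.1, hs.2.trans hrL⟩
        rw [h, ENNReal.ofReal_inv_of_pos (by have := hs.1; positivity), ENNReal.inv_le_inv,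
          ← ENNReal.ofReal_coe_nnreal]
        refine ENNReal.ofReal_le_ofReal ?_
        have h1 : (bdryDist G (γ v) : ℝ) ≤ dist (γ v) p := Metric.infDist_le_dist_of_mem hp
        -- The distance travelled is at most the arc length, so the density at parameter `s` is at
        -- least `1 / (d + s)`.
        have h2 : dist x (γ v) ≤ s := by
          rw [← hγ.source, ← hvs]
          refine BoundedVariationOn.dist_le (s := Icc 0 v)
            (BoundedVariationOn.mono hγ.rectifiable (Icc_subset_Icc_right hv.2)) ?_ ?_ <;>
            simp [hv.1]
        have h3 := dist_triangle_left (γ v) p x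
        linarith
    _ ≤ qhLength G γ := lintegral_mono_set (Icc_subset_Icc_right hrL)

end Curves

/-! ### The cusp as a Jordan domain, via a convex triangle -/

section Cusp

/-- The Euclidean plane. -/
abbrev Plane := EuclideanSpace ℝ (Fin 2)

theorem abs_sub_apply_le_dist (z w : Plane) (i : Fin 2) : |z i - w i| ≤ dist z w := by
  rw [dist_eq_norm]
  exact PiLp.norm_apply_le (z - w) i

theorem dist_le_add_abs (z w : Plane) : dist z w ≤ |z 0 - w 0| + |z 1 - w 1| := by
  rw [EuclideanSpace.dist_eq, Fin.sum_univ_two, Real.dist_eq, Real.dist_eq]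
  refine Real.sqrt_le_iff.2 ⟨by positivity, ?_⟩
  nlinarith [mul_nonneg (abs_nonneg (z 0 - w 0)) (abs_nonneg (z 1 - w 1))]

/-- The bounded domain with an outward cusp at the origin. -/
def cuspDomain : Set Plane := {z | 0 < z 0 ∧ z 0 < 1 ∧ |z 1| < z 0 ^ 2}

/-- The closure of the cusp domain. -/
def closedCusp : Set Plane := {z | 0 ≤ z 0 ∧ z 0 ≤ 1 ∧ |z 1| ≤ z 0 ^ 2}

/-- The open triangle that `wedgeMap` carries onto the cusp domain. -/
def openWedge : Set ℂ := {w | |w.im| < w.re ∧ w.re < 1}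

/-- The closed triangle that `wedgeMap` carries onto the closed cusp. -/
def closedWedge : Set ℂ := {w | |w.im| ≤ w.re ∧ w.re ≤ 1}

/-- The map `(x, v) ↦ (x, x v)`. -/
noncomputable def wedgeMap (w : ℂ) : Plane := !₂[w.re, w.re * w.im]

theorem continuous_wedgeMap : Continuous wedgeMap := by
  unfold wedgeMap
  refine (PiLp.continuous_toLp 2 _).comp (continuous_pi fun i => ?_)
  fin_cases i <;> simp <;> fun_prop

theorem isOpen_cuspDomain : IsOpen cuspDomain := by
  simp only [cuspDomain, ofPred_and]
  exact (isOpen_lt (by fun_prop) (by fun_prop)).inter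
    ((isOpen_lt (by fun_prop) (by fun_prop)).inter (isOpen_lt (by fun_prop) (by fun_prop)))

theorem isClosed_closedCusp : IsClosed closedCusp := by
  simp only [closedCusp, ofPred_and]
  exact (isClosed_le (by fun_prop) (by fun_prop)).inter
    ((isClosed_le (by fun_prop) (by fun_prop)).inter (isClosed_le (by fun_prop) (by fun_prop)))

theorem isOpen_openWedge : IsOpen openWedge := by
  simp only [openWedge, ofPred_and]
  exact (isOpen_lt (by fun_prop) (by fun_prop)).inter (isOpen_lt (by fun_prop) (by fun_prop))

theorem isClosed_closedWedge : IsClosed closedWedge := by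
  simp only [closedWedge, ofPred_and]
  exact (isClosed_le (by fun_prop) (by fun_prop)).inter (isClosed_le (by fun_prop) (by fun_prop))

theorem cuspDomain_subset_closedCusp : cuspDomain ⊆ closedCusp :=
  fun _ h => ⟨h.1.le, h.2.1.le, h.2.2.le⟩

theorem openWedge_subset_closedWedge : openWedge ⊆ closedWedge := fun _ h => ⟨h.1.le, h.2.le⟩

theorem convex_openWedge : Convex ℝ openWedge := by
  intro z hz w hw a b ha hb hab
  obtain ⟨hz1, hz2⟩ := hz
  obtain ⟨hw1, hw2⟩ := hw
  rw [abs_lt] at hz1 hw1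
  simp only [openWedge, mem_ofPred_eq, Complex.add_im, Complex.real_smul, Complex.mul_im,
    Complex.ofReal_re, Complex.ofReal_im, zero_mul, add_zero, Complex.add_re, Complex.mul_re,
    sub_zero]
  obtain rfl : b = 1 - a := by linarith
  rw [abs_lt]
  rcases ha.eq_or_lt with rfl | ha
  · refine ⟨⟨?_, ?_⟩, ?_⟩ <;> linarith
  · refine ⟨⟨?_, ?_⟩, ?_⟩ <;> nlinarith

theorem half_mem_openWedge : (1 / 2 : ℂ) ∈ openWedge := by
  have h : (1 / 2 : ℂ) = ((1 / 2 : ℝ) : ℂ) := by norm_num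
  rw [h]
  simp only [openWedge, mem_ofPred_eq, Complex.ofReal_re, Complex.ofReal_im]
  norm_num

theorem closure_openWedge : closure openWedge = closedWedge := by
  refine (closure_minimal openWedge_subset_closedWedge isClosed_closedWedge).antisymm ?_
  intro w hw
  -- Contraction towards the interior point `1 / 2`.
  have hcont : Continuous fun ε : ℝ => (⟨w.re + ε * (1 / 2 - w.re), (1 - ε) * w.im⟩ : ℂ) := by
    simp_rw [Complex.mk_eq_add_mul_I]
    fun_prop
  have hlim := (hcont.tendsto 0).mono_left (nhdsWithin_le_nhds (s := Ioi 0))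
  have h0 : (⟨w.re + 0 * (1 / 2 - w.re), (1 - 0) * w.im⟩ : ℂ) = w := by
    apply Complex.ext <;> simp
  rw [h0] at hlim
  refine mem_closure_of_tendsto hlim ?_
  filter_upwards [Ioo_mem_nhdsGT (zero_lt_one' ℝ)] with ε hε
  obtain ⟨h1, h2⟩ := hw
  obtain ⟨hε0, hε1⟩ := hε
  refine ⟨?_, ?_⟩
  · simp only
    rw [abs_mul, abs_of_pos (by linarith)]
    nlinarith
  · simp only
    nlinarith

theorem image_wedgeMap_openWedge : wedgeMap '' openWedge = cuspDomain := by
  ext z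
  constructor
  · rintro ⟨w, ⟨h1, h2⟩, rfl⟩
    have h0 : 0 < w.re := (abs_nonneg _).trans_lt h1
    refine ⟨h0, h2, ?_⟩
    simp only [wedgeMap, PiLp.toLp_apply, Matrix.cons_val_zero, Matrix.cons_val_one, abs_mul,
      abs_of_pos h0, pow_two]
    gcongr
  · rintro ⟨h1, h2, h3⟩
    refine ⟨⟨z 0, z 1 / z 0⟩, ⟨?_, h2⟩, ?_⟩
    · simp only [abs_div, abs_of_pos h1]
      rw [div_lt_iff₀ h1]
      linarith
    · ext i
      fin_cases i
      · simp [wedgeMap]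
      · simp [wedgeMap, mul_div_cancel₀ _ h1.ne']

theorem image_wedgeMap_closedWedge : wedgeMap '' closedWedge = closedCusp := by
  ext z
  constructor
  · rintro ⟨w, ⟨h1, h2⟩, rfl⟩
    have h0 : 0 ≤ w.re := (abs_nonneg _).trans h1
    refine ⟨h0, h2, ?_⟩
    simp only [wedgeMap, PiLp.toLp_apply, Matrix.cons_val_zero, Matrix.cons_val_one, abs_mul,
      abs_of_nonneg h0, pow_two]
    gcongr
  · rintro ⟨h1, h2, h3⟩
    rcases h1.eq_or_lt with h0 | h1
    · refine ⟨0, ⟨by simp, by simp⟩, ?_⟩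
      rw [← h0] at h3
      have h4 : z 1 = 0 := by simpa using h3
      ext i
      fin_cases i
      · simp [wedgeMap, ← h0]
      · simp [wedgeMap, h4]
    refine ⟨⟨z 0, z 1 / z 0⟩, ⟨?_, h2⟩, ?_⟩
    · simp only [abs_div, abs_of_pos h1]
      rw [div_le_iff₀ h1]
      linarith
    · ext i
      fin_cases i
      · simp [wedgeMap]
      · simp [wedgeMap, mul_div_cancel₀ _ h1.ne']

/-- The map collapses the line `re = 0`, but the closed triangle meets that line only at its vertex.
-/
theorem injOn_wedgeMap : InjOn wedgeMap closedWedge := by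
  intro w hw z hz h
  have h0 : w.re = z.re := by simpa [wedgeMap] using congrArg (fun p : Plane => p 0) h
  have h1 : w.re * w.im = z.re * z.im := by
    simpa [wedgeMap] using congrArg (fun p : Plane => p 1) h
  refine Complex.ext h0 ?_
  by_cases hre : w.re = 0
  · have hw1 := hw.1
    have hz1 := hz.1
    rw [← h0, hre] at hz1
    rw [hre] at hw1
    rw [abs_nonpos_iff.1 hw1, abs_nonpos_iff.1 hz1]
  · rw [← h0] at h1
    exact mul_left_cancel₀ hre h1

theorem closure_cuspDomain : closure cuspDomain = closedCusp := by
  refine (closure_minimal cuspDomain_subset_closedCusp isClosed_closedCusp).antisymm ?_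
  rw [← image_wedgeMap_closedWedge, ← image_wedgeMap_openWedge, ← closure_openWedge]
  exact image_closure_subset_closure_image continuous_wedgeMap

theorem frontier_cuspDomain : frontier cuspDomain = closedCusp \ cuspDomain := by
  rw [isOpen_cuspDomain.frontier_eq, closure_cuspDomain]

theorem isOpenDomain_cuspDomain : IsOpenDomain cuspDomain where
  isOpen := isOpen_cuspDomain
  isConnected := by
    rw [← image_wedgeMap_openWedge]
    exact (convex_openWedge.isConnected ⟨_, half_mem_openWedge⟩).image _
      continuous_wedgeMap.continuousOn

theorem isBounded_openWedge : Bornology.IsBounded openWedge := by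
  refine Metric.isBounded_ball (x := (0 : ℂ)) (r := 2) |>.subset fun w hw => ?_
  rw [mem_ball_zero_iff]
  have := Complex.norm_le_abs_re_add_abs_im w
  have h0 : 0 < w.re := (abs_nonneg _).trans_lt hw.1
  have h1 := hw.1
  have h2 := hw.2
  rw [abs_of_pos h0] at this
  linarith

/-- A homeomorphism of the plane takes the boundary of the convex triangle to the unit circle;
composing its inverse with `wedgeMap`, injective up to the boundary, parametrizes the boundary of
the cusp. -/
theorem isBoundedJordanDomain_cuspDomain : IsBoundedJordanDomain cuspDomain where
  isOpenDomain := isOpenDomain_cuspDomain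
  isBounded := by
    refine Metric.isBounded_closedBall (x := (0 : Plane)) (r := 2) |>.subset fun z hz => ?_
    rw [Metric.mem_closedBall]
    have := dist_le_add_abs z 0
    obtain ⟨h0, h1, h2⟩ := hz
    simp only [PiLp.zero_apply, sub_zero, abs_of_pos h0] at this
    nlinarith
  frontier_jordan := by
    obtain ⟨e, -, -, he⟩ := exists_homeomorph_image_interior_closure_frontier_eq_unitBall
      convex_openWedge (by rw [isOpen_openWedge.interior_eq]; exact ⟨_, half_mem_openWedge⟩)
      isBounded_openWedge
    have hfr : e.symm '' Metric.sphere 0 1 = frontier openWedge := by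
      rw [← he, ← image_comp]
      simp
    have hfr' : frontier openWedge = closedWedge \ openWedge := by
      rw [isOpen_openWedge.frontier_eq, closure_openWedge]
    have hmem : ∀ z : Circle, e.symm z ∈ closedWedge \ openWedge := fun z => by
      rw [← hfr', ← hfr]
      exact mem_image_of_mem _ (mem_sphere_zero_iff_norm.2 (Circle.norm_coe z))
    refine ⟨fun z => wedgeMap (e.symm z), ?_, ?_, ?_⟩
    · exact continuous_wedgeMap.comp (e.symm.continuous.comp continuous_subtype_val)
    · intro z w h
      exact Circle.coe_injective (e.symm.injective (injOn_wedgeMap (hmem z).1 (hmem w).1 h))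
    · have : range (fun z : Circle => wedgeMap (e.symm z)) =
          wedgeMap '' (e.symm '' Metric.sphere 0 1) := by
        ext p
        simp only [mem_range, mem_image, exists_exists_and_eq_and]
        constructor
        · rintro ⟨z, rfl⟩
          exact ⟨z, mem_sphere_zero_iff_norm.2 (Circle.norm_coe z), rfl⟩
        · rintro ⟨z, hz, rfl⟩
          exact ⟨⟨z, by simpa [Submonoid.unitSphere] using hz⟩, rfl⟩
      rw [this, hfr, hfr', frontier_cuspDomain,
        injOn_wedgeMap.image_sdiff_subset openWedge_subset_closedWedge, image_wedgeMap_closedWedge,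
        image_wedgeMap_openWedge]

end Cusp

/-! ### The cusp is uniform with `φ(r) = 18 r` -/

section InnerUniform

/-- A lower bound, up to a factor, for the distance to the boundary of the cusp domain. -/
noncomputable def cuspHeight (z : Plane) : ℝ := min (z 0 ^ 2 - |z 1|) (1 - z 0)

theorem cuspHeight_pos {z : Plane} (hz : z ∈ cuspDomain) : 0 < cuspHeight z :=
  lt_min (sub_pos.2 hz.2.2) (sub_pos.2 hz.2.1)

theorem abs_sq_sub_sq_le {a b : ℝ} (ha : a ∈ Icc (0 : ℝ) 1) (hb : b ∈ Icc (0 : ℝ) 1) :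
    |a ^ 2 - b ^ 2| ≤ 2 * |a - b| := by
  rw [sq_sub_sq, abs_mul]
  refine mul_le_mul_of_nonneg_right ?_ (abs_nonneg _)
  rw [abs_of_nonneg (add_nonneg ha.1 hb.1)]
  linarith [ha.2, hb.2]

theorem nonempty_frontier_cuspDomain : (frontier cuspDomain).Nonempty := by
  rw [frontier_cuspDomain]
  exact ⟨0, ⟨by simp, by simp, by simp⟩, fun h => lt_irrefl _ h.1⟩

/-- Moving by `d` changes `x² - |y|` by at most `3d`, since `x²` is 2-Lipschitz on `[0, 1]`, and `1
- x` by at most `d`. At a boundary point one of these two quantities is nonpositive. -/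
theorem cuspHeight_le_three_mul_bdryDist {z : Plane} (hz : z ∈ cuspDomain) :
    cuspHeight z ≤ 3 * bdryDist cuspDomain z := by
  suffices h : cuspHeight z / 3 ≤ Metric.infDist z (frontier cuspDomain) by
    have h' : (bdryDist cuspDomain z : ℝ) = Metric.infDist z (frontier cuspDomain) := rfl
    rw [h']
    linarith
  refine (Metric.le_infDist nonempty_frontier_cuspDomain).2 fun w hw => ?_
  rw [frontier_cuspDomain] at hw
  obtain ⟨⟨hw0, hw1, hw2⟩, hwn⟩ := hw
  have d0 := abs_sub_apply_le_dist z w 0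
  have d1 := abs_sub_apply_le_dist z w 1
  have hsq := abs_sq_sub_sq_le (a := z 0) (b := w 0) ⟨hz.1.le, hz.2.1.le⟩ ⟨hw0, hw1⟩
  have hm1 : cuspHeight z ≤ z 0 ^ 2 - |z 1| := min_le_left _ _
  have hm2 : cuspHeight z ≤ 1 - z 0 := min_le_right _ _
  have habs := abs_sub_abs_le_abs_sub (w 1) (z 1)
  rw [abs_sub_comm] at habs
  have hle := le_abs_self (z 0 ^ 2 - w 0 ^ 2)
  have hle' := neg_abs_le (z 0 - w 0)
  by_cases h1 : w 0 = 1
  · linarith [dist_nonneg (x := z) (y := w)]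
  · have hw3 : w 0 ^ 2 ≤ |w 1| := by
      by_contra! hlt
      refine hwn ⟨?_, lt_of_le_of_ne hw1 h1, hlt⟩
      refine lt_of_le_of_ne hw0 fun h0 => ?_
      rw [← h0] at hlt
      have := abs_nonneg (w 1)
      norm_num at hlt
      linarith
    linarith

/-- The boundary points directly above or below `z`, and directly to its right, are at the two
distances in the minimum. -/
theorem bdryDist_le_cuspHeight {z : Plane} (hz : z ∈ cuspDomain) :
    (bdryDist cuspDomain z : ℝ) ≤ cuspHeight z := by
  have hle : ∀ w ∈ closedCusp \ cuspDomain,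
      (bdryDist cuspDomain z : ℝ) ≤ |z 0 - w 0| + |z 1 - w 1| := fun w hw => by
    rw [← frontier_cuspDomain] at hw
    exact (Metric.infDist_le_dist_of_mem hw).trans (dist_le_add_abs z w)
  obtain ⟨h0, h1, h2⟩ := hz
  have hsq : (0 : ℝ) ≤ z 0 ^ 2 := sq_nonneg _
  refine le_min ?_ ?_
  · rcases le_total 0 (z 1) with hs | hs
    · have := hle !₂[z 0, z 0 ^ 2] ⟨⟨by simpa using h0.le, by simpa using h1.le, by simp⟩,
        fun h => by simpa using h.2.2⟩
      rw [abs_of_nonneg hs] at h2 ⊢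
      simp only [Matrix.cons_val_zero, Matrix.cons_val_one, sub_self, abs_zero,
        zero_add] at this
      rw [abs_sub_comm, abs_of_pos (by linarith)] at this
      exact this
    · have := hle !₂[z 0, -z 0 ^ 2] ⟨⟨by simpa using h0.le, by simpa using h1.le, by simp⟩,
        fun h => by simpa using h.2.2⟩
      rw [abs_of_nonpos hs] at h2 ⊢
      simp only [Matrix.cons_val_zero, Matrix.cons_val_one, sub_self, abs_zero,
        zero_add] at this
      rw [abs_of_pos (by linarith)] at this
      linarith
  · have hz1 : |z 1| ≤ 1 := by nlinarith
    have := hle !₂[1, z 1] ⟨⟨by simp, by simp, by simpa using hz1⟩,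
        fun h => by simpa using h.2.1⟩
    simp only [Matrix.cons_val_zero, Matrix.cons_val_one, sub_self, abs_zero,
      add_zero] at this
    rw [abs_sub_comm, abs_of_pos (by linarith)] at this
    exact this

/-- The curve `s ↦ (x, x² t)`, where `(x, t)` runs along a line segment. -/
noncomputable def cuspCurve (a b : Plane) (s : ℝ) : Plane :=
  !₂[(1 - s) * a 0 + s * b 0, ((1 - s) * a 0 + s * b 0) ^ 2 *
    ((1 - s) * (a 1 / a 0 ^ 2) + s * (b 1 / b 0 ^ 2))]

theorem sq_mul_abs_le_of_sq_mul_abs_le {x₁ x₂ t₁ t₂ m s : ℝ} (h₁ : 0 < x₁) (h₂ : 0 < x₂)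
    (hm : 0 ≤ m) (hs : s ∈ Icc (0 : ℝ) 1) (ht₁ : x₁ ^ 2 * |t₁| ≤ x₁ ^ 2 - m)
    (ht₂ : x₂ ^ 2 * |t₂| ≤ x₂ ^ 2 - m) :
    ((1 - s) * x₁ + s * x₂) ^ 2 * |(1 - s) * t₁ + s * t₂| ≤ ((1 - s) * x₁ + s * x₂) ^ 2 - m := by
  have h1s : 0 ≤ 1 - s := sub_nonneg.2 hs.2
  -- Dividing by `x²` turns the bounds into `|τ| ≤ 1 - m x⁻²`, which convexity of `x⁻²` preserves.
  have hconv := (convexOn_zpow (𝕜 := ℝ) (-2)).2 (mem_Ioi.2 h₁) (mem_Ioi.2 h₂) h1s hs.1 (by ring)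
  simp only [smul_eq_mul] at hconv
  set x := (1 - s) * x₁ + s * x₂ with hx
  have hx0 : 0 < x := by
    rcases hs.1.eq_or_lt with h | h
    · rw [hx, ← h]; simpa using h₁
    · rw [hx]; positivity
  have hz : ∀ y : ℝ, y ^ (-2 : ℤ) = (y ^ 2)⁻¹ := fun y => by
    rw [zpow_neg]; norm_cast
  simp only [hz] at hconv
  have e₁ : |t₁| ≤ 1 - m * (x₁ ^ 2)⁻¹ := by
    have hp : 0 < x₁ ^ 2 := by positivity
    have : (x₁ ^ 2)⁻¹ * (x₁ ^ 2 * |t₁|) ≤ (x₁ ^ 2)⁻¹ * (x₁ ^ 2 - m) := by gcongr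
    rw [inv_mul_cancel_left₀ hp.ne', mul_sub, inv_mul_cancel₀ hp.ne'] at this
    linarith
  have e₂ : |t₂| ≤ 1 - m * (x₂ ^ 2)⁻¹ := by
    have hp : 0 < x₂ ^ 2 := by positivity
    have : (x₂ ^ 2)⁻¹ * (x₂ ^ 2 * |t₂|) ≤ (x₂ ^ 2)⁻¹ * (x₂ ^ 2 - m) := by gcongr
    rw [inv_mul_cancel_left₀ hp.ne', mul_sub, inv_mul_cancel₀ hp.ne'] at this
    linarith
  have habs : |(1 - s) * t₁ + s * t₂| ≤ (1 - s) * |t₁| + s * |t₂| := by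
    refine (abs_add_le _ _).trans_eq ?_
    rw [abs_mul, abs_mul, abs_of_nonneg h1s, abs_of_nonneg hs.1]
  have key : |(1 - s) * t₁ + s * t₂| ≤ 1 - m * (x ^ 2)⁻¹ := by
    have := mul_le_mul_of_nonneg_left hconv hm
    have f₁ := mul_le_mul_of_nonneg_left e₁ h1s
    have f₂ := mul_le_mul_of_nonneg_left e₂ hs.1
    linarith
  have hp : 0 < x ^ 2 := by positivity
  calc _ ≤ x ^ 2 * (1 - m * (x ^ 2)⁻¹) := by gcongr
    _ = x ^ 2 - m := by field_simp

theorem sq_mul_abs_div_sq {z : Plane} (hz : z ∈ cuspDomain) :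
    z 0 ^ 2 * |z 1 / z 0 ^ 2| = |z 1| := by
  have hp : 0 < z 0 ^ 2 := pow_pos hz.1 2
  rw [abs_div, abs_of_pos hp, mul_div_cancel₀ _ hp.ne']

variable {a b : Plane}

theorem cuspCurve_mem (ha : a ∈ cuspDomain) (hb : b ∈ cuspDomain) {s : ℝ}
    (hs : s ∈ Icc (0 : ℝ) 1) :
    cuspCurve a b s ∈ cuspDomain ∧
      min (cuspHeight a) (cuspHeight b) ≤ cuspHeight (cuspCurve a b s) := by
  set m := min (cuspHeight a) (cuspHeight b) with hm
  have hm0 : 0 < m := lt_min (cuspHeight_pos ha) (cuspHeight_pos hb)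
  have hma : m ≤ cuspHeight a := min_le_left _ _
  have hmb : m ≤ cuspHeight b := min_le_right _ _
  obtain ⟨ha1, ha2⟩ := le_min_iff.1 hma
  obtain ⟨hb1, hb2⟩ := le_min_iff.1 hmb
  have h1s : 0 ≤ 1 - s := sub_nonneg.2 hs.2
  have key := sq_mul_abs_le_of_sq_mul_abs_le (t₁ := a 1 / a 0 ^ 2) (t₂ := b 1 / b 0 ^ 2)
    ha.1 hb.1 hm0.le hs (by rw [sq_mul_abs_div_sq ha]; linarith)
    (by rw [sq_mul_abs_div_sq hb]; linarith)
  have hx0 : 0 < (1 - s) * a 0 + s * b 0 := by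
    have := ha.1; have := hb.1
    rcases hs.1.eq_or_lt with h | h
    · rw [← h]; simpa
    · positivity
  have hx1 : (1 - s) * a 0 + s * b 0 ≤ 1 - m := by nlinarith [hs.1]
  have h0 : cuspCurve a b s 0 = (1 - s) * a 0 + s * b 0 := rfl
  have h1 : |cuspCurve a b s 1| = ((1 - s) * a 0 + s * b 0) ^ 2 *
      |(1 - s) * (a 1 / a 0 ^ 2) + s * (b 1 / b 0 ^ 2)| := by
    change |((1 - s) * a 0 + s * b 0) ^ 2 * _| = _
    rw [abs_mul, abs_of_nonneg (sq_nonneg _)]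
  rw [← h1, ← h0] at key
  rw [← h0] at hx0 hx1
  refine ⟨⟨hx0, by linarith, by linarith⟩, le_min (by linarith) (by linarith)⟩

theorem abs_convexComb_le_one {s t₁ t₂ : ℝ} (hs : s ∈ Icc (0 : ℝ) 1) (h₁ : |t₁| ≤ 1) (h₂ : |t₂| ≤ 1) :
    |(1 - s) * t₁ + s * t₂| ≤ 1 := by
  have h1s : 0 ≤ 1 - s := sub_nonneg.2 hs.2
  refine (abs_add_le _ _).trans ?_
  rw [abs_mul, abs_mul, abs_of_nonneg h1s, abs_of_nonneg hs.1]
  nlinarith [hs.1]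

/-- The constant is `6 = 1 + (2 + 3)`: the first coordinate contributes 1; in `x² τ`, varying `x²`
contributes 2 and varying `τ` contributes 3. Near the tip `τ` may vary fast, but it enters only with
the weight `x²`. -/
theorem dist_cuspCurve_le (ha : a ∈ cuspDomain) (hb : b ∈ cuspDomain) {s r : ℝ}
    (hs : s ∈ Icc (0 : ℝ) 1) (hr : r ∈ Icc (0 : ℝ) 1) :
    dist (cuspCurve a b s) (cuspCurve a b r) ≤ 6 * dist a b * |s - r| := by
  have hxs := (cuspCurve_mem ha hb hs).1
  have hxr := (cuspCurve_mem ha hb hr).1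
  have d0 := abs_sub_apply_le_dist a b 0
  have d1 := abs_sub_apply_le_dist a b 1
  have habs : ∀ z ∈ cuspDomain, |z 1 / z 0 ^ 2| ≤ 1 := fun z hz => by
    have hp : 0 < z 0 ^ 2 := pow_pos hz.1 2
    rw [abs_div, abs_of_pos hp, div_le_one hp]
    exact hz.2.2.le
  have hta := habs a ha
  have htb := habs b hb
  set ta := a 1 / a 0 ^ 2 with hta_def
  set tb := b 1 / b 0 ^ 2 with htb_def
  have hya : a 1 = a 0 ^ 2 * ta := by rw [hta_def, mul_div_cancel₀ _ (pow_pos ha.1 2).ne']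
  have hyb : b 1 = b 0 ^ 2 * tb := by rw [htb_def, mul_div_cancel₀ _ (pow_pos hb.1 2).ne']
  have hsq := abs_sq_sub_sq_le (a := a 0) (b := b 0) ⟨ha.1.le, ha.2.1.le⟩ ⟨hb.1.le, hb.2.1.le⟩
  have hprod : ∀ t : ℝ, |t| ≤ 1 → |t * (a 0 ^ 2 - b 0 ^ 2)| ≤ 2 * dist a b := fun t ht => by
    rw [abs_mul]
    have := mul_le_mul_of_nonneg_right ht (abs_nonneg (a 0 ^ 2 - b 0 ^ 2))
    linarith
  have hMa : a 0 ^ 2 * |ta - tb| ≤ 3 * dist a b := by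
    rw [← abs_of_nonneg (sq_nonneg (a 0)), ← abs_mul,
      show a 0 ^ 2 * (ta - tb) = (a 1 - b 1) - tb * (a 0 ^ 2 - b 0 ^ 2) by rw [hya, hyb]; ring]
    have := abs_sub (a 1 - b 1) (tb * (a 0 ^ 2 - b 0 ^ 2))
    linarith [hprod tb htb]
  have hMb : b 0 ^ 2 * |ta - tb| ≤ 3 * dist a b := by
    rw [← abs_of_nonneg (sq_nonneg (b 0)), ← abs_mul,
      show b 0 ^ 2 * (ta - tb) = (a 1 - b 1) - ta * (a 0 ^ 2 - b 0 ^ 2) by rw [hya, hyb]; ring]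
    have := abs_sub (a 1 - b 1) (ta * (a 0 ^ 2 - b 0 ^ 2))
    linarith [hprod ta hta]
  -- Convexity of `x²` carries the weighted bound from the endpoints to every point of the curve.
  have hMr : cuspCurve a b r 0 ^ 2 * |ta - tb| ≤ 3 * dist a b := by
    have h1r : 0 ≤ 1 - r := sub_nonneg.2 hr.2
    have hconv : cuspCurve a b r 0 ^ 2 ≤ (1 - r) * a 0 ^ 2 + r * b 0 ^ 2 := by
      change ((1 - r) * a 0 + r * b 0) ^ 2 ≤ _
      nlinarith [mul_nonneg (mul_nonneg h1r hr.1) (sq_nonneg (a 0 - b 0))]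
    have h1 := mul_le_mul_of_nonneg_right hconv (abs_nonneg (ta - tb))
    have h2 := mul_le_mul_of_nonneg_left hMa h1r
    have h3 := mul_le_mul_of_nonneg_left hMb hr.1
    linarith
  have hts : |(1 - s) * ta + s * tb| ≤ 1 := abs_convexComb_le_one hs hta htb
  have hΔ0 : cuspCurve a b s 0 - cuspCurve a b r 0 = -((a 0 - b 0) * (s - r)) := by
    change ((1 - s) * a 0 + s * b 0) - ((1 - r) * a 0 + r * b 0) = _
    ring
  have hΔ0' : |cuspCurve a b s 0 - cuspCurve a b r 0| ≤ dist a b * |s - r| := by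
    rw [hΔ0, abs_neg, abs_mul]
    gcongr
  have hΔ1 : cuspCurve a b s 1 - cuspCurve a b r 1 =
      ((1 - s) * ta + s * tb) * (cuspCurve a b s 0 ^ 2 - cuspCurve a b r 0 ^ 2)
        - cuspCurve a b r 0 ^ 2 * ((ta - tb) * (s - r)) := by
    change cuspCurve a b s 0 ^ 2 * ((1 - s) * ta + s * tb) -
      cuspCurve a b r 0 ^ 2 * ((1 - r) * ta + r * tb) = _
    ring
  have hsq' := abs_sq_sub_sq_le (a := cuspCurve a b s 0) (b := cuspCurve a b r 0)
    ⟨hxs.1.le, hxs.2.1.le⟩ ⟨hxr.1.le, hxr.2.1.le⟩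
  have hΔ1' : |cuspCurve a b s 1 - cuspCurve a b r 1| ≤ 5 * (dist a b * |s - r|) := by
    rw [hΔ1]
    refine (abs_sub _ _).trans ?_
    rw [abs_mul, abs_mul, abs_mul, abs_of_nonneg (sq_nonneg (cuspCurve a b r 0)), ← mul_assoc]
    have h1 := mul_le_mul_of_nonneg_right hts
      (abs_nonneg (cuspCurve a b s 0 ^ 2 - cuspCurve a b r 0 ^ 2))
    have h2 := mul_le_mul_of_nonneg_right hMr (abs_nonneg (s - r))
    linarith
  have := dist_le_add_abs (cuspCurve a b s) (cuspCurve a b r)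
  linarith

theorem isRectifiableCurve_cuspCurve (ha : a ∈ cuspDomain) (hb : b ∈ cuspDomain) :
    IsRectifiableCurve cuspDomain a b (cuspCurve a b) ∧
      eVariationOn (cuspCurve a b) (Icc 0 1) ≤ 6 * edist a b := by
  have hlip : LipschitzOnWith (6 * nndist a b) (cuspCurve a b) (Icc 0 1) :=
    LipschitzOnWith.of_dist_le_mul fun s hs r hr => by
      simpa [Real.dist_eq] using dist_cuspCurve_le ha hb hs hr
  have hvar : eVariationOn (cuspCurve a b) (Icc 0 1) ≤ 6 * edist a b := by
    have := hlip.comp_eVariationOn_le (f := cuspCurve a b) (g := id) (s := Icc (0 : ℝ) 1)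
      (mapsTo_id _)
    rw [Function.comp_id, eVariationOn_id_Icc] at this
    simpa [← edist_nndist] using this
  refine ⟨⟨hlip.continuousOn, fun s hs => (cuspCurve_mem ha hb hs).1, ?_, ?_, ?_⟩, hvar⟩
  · have := (pow_pos ha.1 2).ne'
    ext i
    fin_cases i
    · simp [cuspCurve]
    · simp [cuspCurve, mul_div_cancel₀ _ this]
  · have := (pow_pos hb.1 2).ne'
    ext i
    fin_cases i
    · simp [cuspCurve]
    · simp [cuspCurve, mul_div_cancel₀ _ this]
  · exact (hvar.trans_lt (ENNReal.mul_lt_top (by norm_num) (edist_lt_top a b))).ne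

theorem isPhiUniform_cuspDomain :
    IsPhiUniform (Homeomorph.mulLeft₀ (18 : ℝ≥0) (by norm_num)) cuspDomain where
  strictMono := fun x y h => by
    simpa using h
  map_zero := by simp
  isOpenDomain := isOpenDomain_cuspDomain
  ne_univ := fun h => by
    have : (0 : Plane) ∈ cuspDomain := h ▸ mem_univ _
    exact lt_irrefl _ this.1
  qhDist_le := fun a ha b hb => by
    obtain ⟨hγ, hvar⟩ := isRectifiableCurve_cuspCurve ha hb
    set m := min (bdryDist cuspDomain a) (bdryDist cuspDomain b) with hm
    have hpos : ∀ z ∈ cuspDomain, 0 < bdryDist cuspDomain z := fun z hz => by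
      have h1 := cuspHeight_pos hz
      have h2 := cuspHeight_le_three_mul_bdryDist hz
      exact_mod_cast (by linarith : (0 : ℝ) < bdryDist cuspDomain z)
    have hm0 : 0 < m := lt_min (hpos a ha) (hpos b hb)
    have hlow : ∀ u ∈ Icc (0 : ℝ) 1,
        ((m / 3 : ℝ≥0) : ℝ≥0∞) ≤ bdryDist cuspDomain (cuspCurve a b u) := fun u hu => by
      obtain ⟨h1, h2⟩ := cuspCurve_mem ha hb hu
      have h3 := cuspHeight_le_three_mul_bdryDist h1
      have h4 : (m : ℝ) ≤ min (cuspHeight a) (cuspHeight b) := by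
        rw [hm, NNReal.coe_min]
        exact min_le_min (bdryDist_le_cuspHeight ha) (bdryDist_le_cuspHeight hb)
      rw [ENNReal.coe_le_coe, ← NNReal.coe_le_coe, NNReal.coe_div, NNReal.coe_ofNat]
      linarith
    calc qhDist cuspDomain a b ≤ qhLength cuspDomain (cuspCurve a b) := iInf₂_le _ hγ
      _ ≤ ((m / 3 : ℝ≥0) : ℝ≥0∞)⁻¹ * eVariationOn (cuspCurve a b) (Icc 0 1) :=
        hγ.qhLength_le hlow
      _ ≤ ((m / 3 : ℝ≥0) : ℝ≥0∞)⁻¹ * (6 * edist a b) := by gcongr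
      _ = _ := by
        rw [← ENNReal.coe_inv (by positivity), edist_nndist]
        simp only [Homeomorph.coe_mulLeft₀]
        norm_cast
        field_simp
        ring

end InnerUniform

/-! ### The exterior is a domain but not uniform -/

section Exterior

theorem isPathConnected_compl_closedCusp : IsPathConnected closedCuspᶜ := by
  have hleft : ∀ z : Plane, z 0 = -1 → z ∈ closedCuspᶜ := fun z hz h => by
    have := h.1
    linarith
  have hhigh : ∀ z : Plane, 2 ≤ |z 1| → z ∈ closedCuspᶜ := fun z hz h => by
    obtain ⟨h0, h1, h2⟩ := h
    nlinarith
  refine ⟨!₂[-1, 0], hleft _ rfl, fun {z} hz => JoinedIn.symm ?_⟩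
  -- `ε` is a sign of `z 1`: the path moves vertically away from the axis to height at least 2, then
  -- across to `x = -1`, then back to the axis.
  obtain ⟨ε, hε, hz1⟩ : ∃ ε : ℝ, |ε| = 1 ∧ z 1 = ε * |z 1| := by
    rcases le_total 0 (z 1) with h | h
    · exact ⟨1, by simp, by rw [abs_of_nonneg h, one_mul]⟩
    · exact ⟨-1, by simp, by rw [abs_of_nonpos h]; ring⟩
  have habs : ∀ r : ℝ, 0 ≤ r → |ε * (|z 1| + r)| = |z 1| + r := fun r hr => by
    rw [abs_mul, hε, one_mul, abs_of_nonneg (by positivity)]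
  have s₁ : JoinedIn closedCuspᶜ z !₂[z 0, ε * (|z 1| + 2)] := by
    refine JoinedIn.of_segment_subset ?_
    rintro w ⟨s, t, hs, ht, hst, rfl⟩ ⟨h0, h1, h2⟩
    obtain rfl : s = 1 - t := by linarith
    have e0 : ((1 - t) • z + t • !₂[z 0, ε * (|z 1| + 2)]) 0 = z 0 := by
      simp
      ring
    have e1 : ((1 - t) • z + t • !₂[z 0, ε * (|z 1| + 2)]) 1 = ε * (|z 1| + 2 * t) := by
      simp only [PiLp.add_apply, PiLp.smul_apply, smul_eq_mul, Matrix.cons_val_one]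
      nth_rewrite 1 [hz1]
      simp
      ring
    rw [e0] at h0 h1 h2
    rw [e1, habs _ (by positivity)] at h2
    exact hz ⟨h0, h1, by linarith⟩
  have s₂ : JoinedIn closedCuspᶜ !₂[z 0, ε * (|z 1| + 2)] !₂[-1, ε * (|z 1| + 2)] := by
    refine JoinedIn.of_segment_subset ?_
    rintro w ⟨s, t, hs, ht, hst, rfl⟩
    refine hhigh _ ?_
    obtain rfl : s = 1 - t := by linarith
    have e1 : ((1 - t) • !₂[z 0, ε * (|z 1| + 2)] + t • !₂[-1, ε * (|z 1| + 2)] : Plane) 1 =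
        ε * (|z 1| + 2) := by
      simp
      ring
    rw [e1, habs _ (by norm_num)]
    linarith [abs_nonneg (z 1)]
  have s₃ : JoinedIn closedCuspᶜ !₂[-1, ε * (|z 1| + 2)] !₂[-1, 0] := by
    refine JoinedIn.of_segment_subset ?_
    rintro w ⟨s, t, hs, ht, hst, rfl⟩
    refine hleft _ ?_
    obtain rfl : s = 1 - t := by linarith
    simp
    ring
  exact (s₁.trans s₂).trans s₃

theorem isOpenDomain_compl_closedCusp : IsOpenDomain closedCuspᶜ where
  isOpen := isClosed_closedCusp.isOpen_compl
  isConnected := isPathConnected_compl_closedCusp.isConnected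

theorem frontier_compl_closedCusp_subset : frontier closedCuspᶜ ⊆ closedCusp := by
  rw [frontier_compl]
  exact isClosed_closedCusp.frontier_subset

theorem mem_frontier_compl_closedCusp {t : ℝ} (ht : t ∈ Icc (0 : ℝ) 1) :
    !₂[t, t ^ 2] ∈ frontier closedCuspᶜ := by
  rw [frontier_compl, frontier_eq_closure_inter_closure]
  refine ⟨subset_closure ⟨by simpa using ht.1, by simpa using ht.2, by simp⟩, ?_⟩
  have hcont : Continuous fun ε : ℝ => (!₂[t, t ^ 2 + ε] : Plane) := by
    refine (PiLp.continuous_toLp 2 _).comp (continuous_pi fun i => ?_)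
    fin_cases i <;> simp <;> fun_prop
  have hlim := (hcont.tendsto 0).mono_left (nhdsWithin_le_nhds (s := Ioi 0))
  rw [add_zero] at hlim
  refine mem_closure_of_tendsto hlim ?_
  filter_upwards [self_mem_nhdsWithin] with ε hε h
  have h2 : |t ^ 2 + ε| ≤ t ^ 2 := h.2.2
  have := le_abs_self (t ^ 2 + ε)
  rw [mem_Ioi] at hε
  linarith

/-- The function `x² - |y|` equals `-t²` at `z` and is nonnegative on the closed cusp, and it
changes by at most three times the distance. -/
theorem sq_le_three_mul_bdryDist_compl {t : ℝ} (ht : t ∈ Icc (0 : ℝ) 1) {z : Plane}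
    (h0 : z 0 = t) (h1 : |z 1| = 2 * t ^ 2) : t ^ 2 ≤ 3 * bdryDist closedCuspᶜ z := by
  suffices h : t ^ 2 / 3 ≤ Metric.infDist z (frontier closedCuspᶜ) by
    have h' : (bdryDist closedCuspᶜ z : ℝ) = Metric.infDist z (frontier closedCuspᶜ) := rfl
    rw [h']
    linarith
  refine (Metric.le_infDist ⟨_, mem_frontier_compl_closedCusp ht⟩).2 fun w hw => ?_
  obtain ⟨hw0, hw1, hw2⟩ := frontier_compl_closedCusp_subset hw
  have d0 := abs_sub_apply_le_dist z w 0
  have d1 := abs_sub_apply_le_dist z w 1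
  have hsq := abs_sq_sub_sq_le ht ⟨hw0, hw1⟩
  rw [h0] at d0
  have := neg_abs_le (t ^ 2 - w 0 ^ 2)
  have := abs_sub_abs_le_abs_sub (z 1) (w 1)
  linarith

/-- A curve in the exterior between two points on opposite sides of the axis has to go around the
cusp. -/
theorem ofReal_log_inv_le_qhDist {t : ℝ} (ht : t ∈ Ioc (0 : ℝ) (1 / 2)) :
    ENNReal.ofReal (Real.log t⁻¹) ≤ qhDist closedCuspᶜ !₂[t, 2 * t ^ 2] !₂[t, -(2 * t ^ 2)] := by
  obtain ⟨ht0, ht1⟩ := ht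
  refine le_iInf₂ fun γ hγ => ?_
  have hcont : ContinuousOn (fun s => γ s 1) (Icc 0 1) :=
    (by fun_prop : Continuous fun z : Plane => z 1).comp_continuousOn hγ.continuousOn
  have hzero : (0 : ℝ) ∈ Icc (γ 1 1) (γ 0 1) := by
    rw [hγ.source, hγ.target]
    constructor <;> simp <;> positivity
  obtain ⟨u, hu, hu0⟩ := intermediate_value_Icc' zero_le_one hcont hzero
  simp only at hu0
  have hfar : t ≤ dist (!₂[t, 2 * t ^ 2] : Plane) (γ u) := by
    refine le_trans ?_ (abs_sub_apply_le_dist _ _ 0)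
    change t ≤ |t - γ u 0|
    -- Otherwise the crossing of the axis has abscissa in `(0, 2t)`, inside `(0, 1)`, hence lies in
    -- the closed cusp.
    by_contra! hlt
    rw [abs_lt] at hlt
    refine hγ.mapsTo hu ⟨by linarith, by linarith, ?_⟩
    rw [hu0, abs_zero]
    positivity
  set a : Plane := !₂[t, 2 * t ^ 2] with ha
  set p : Plane := !₂[t, t ^ 2] with hp
  have hd0 : 0 < dist a p := by
    refine lt_of_lt_of_le ?_ (abs_sub_apply_le_dist a p 1)
    change 0 < |2 * t ^ 2 - t ^ 2|
    rw [show 2 * t ^ 2 - t ^ 2 = t ^ 2 by ring]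
    positivity
  have hd1 : dist a p ≤ t ^ 2 := by
    refine (dist_le_add_abs a p).trans_eq ?_
    change |t - t| + |2 * t ^ 2 - t ^ 2| = t ^ 2
    rw [show 2 * t ^ 2 - t ^ 2 = t ^ 2 by ring, sub_self, abs_zero, zero_add,
      abs_of_nonneg (sq_nonneg t)]
  refine le_trans (ENNReal.ofReal_le_ofReal (Real.log_le_log (by positivity) ?_))
    (hγ.log_le_qhLength (mem_frontier_compl_closedCusp ⟨ht0.le, by linarith⟩) hd0 hu ht0.le hfar)
  rw [le_div_iff₀ hd0]
  calc t⁻¹ * dist a p ≤ t⁻¹ * t ^ 2 := by gcongr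
    _ = t := by field_simp
    _ ≤ dist a p + t := by linarith

theorem not_isPhiUniform_compl_closedCusp (ψ : ℝ≥0 ≃ₜ ℝ≥0) : ¬ IsPhiUniform ψ closedCuspᶜ := by
  intro h
  obtain ⟨M, hM⟩ : ∃ M : ℝ, M = (ψ 12 : ℝ≥0) := ⟨_, rfl⟩
  have hM0 : 0 ≤ M := hM ▸ NNReal.coe_nonneg _
  -- Chosen so that `log t⁻¹ = M + 1` exceeds `ψ 12`; here 12 is `4t²` divided by `t² / 3`.
  set t := Real.exp (-(M + 1)) with ht
  have ht0 : 0 < t := Real.exp_pos _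
  have ht1 : t ≤ 1 / 2 := by
    rw [ht, Real.exp_neg, one_div]
    refine inv_anti₀ two_pos ?_
    have := Real.add_one_le_exp (M + 1)
    linarith
  have htI : t ∈ Icc (0 : ℝ) 1 := ⟨ht0.le, by linarith⟩
  have hlog : Real.log t⁻¹ = M + 1 := by rw [Real.log_inv, ht, Real.log_exp, neg_neg]
  have hlow := ofReal_log_inv_le_qhDist ⟨ht0, ht1⟩
  rw [hlog] at hlow
  set a : Plane := !₂[t, 2 * t ^ 2] with ha
  set b : Plane := !₂[t, -(2 * t ^ 2)] with hb
  have ha1 : |a 1| = 2 * t ^ 2 := abs_of_nonneg (show (0 : ℝ) ≤ 2 * t ^ 2 by positivity)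
  have hb1 : |b 1| = 2 * t ^ 2 := by
    change |-(2 * t ^ 2)| = _
    rw [abs_neg, abs_of_nonneg (by positivity)]
  have hmem : ∀ z : Plane, z 0 = t → |z 1| = 2 * t ^ 2 → z ∈ closedCuspᶜ := fun z h0 h1 hz => by
    have := hz.2.2
    rw [h0, h1] at this
    nlinarith
  have hup := h.qhDist_le a (hmem a rfl ha1) b (hmem b rfl hb1)
  have hratio : nndist a b / min (bdryDist closedCuspᶜ a) (bdryDist closedCuspᶜ b) ≤ 12 := by
    refine div_le_of_le_mul₀ zero_le zero_le ?_
    rw [← NNReal.coe_le_coe, NNReal.coe_mul, NNReal.coe_min, coe_nndist, NNReal.coe_ofNat]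
    have h1 := sq_le_three_mul_bdryDist_compl htI (z := a) rfl ha1
    have h2 := sq_le_three_mul_bdryDist_compl htI (z := b) rfl hb1
    have h3 : t ^ 2 / 3 ≤ min (bdryDist closedCuspᶜ a : ℝ) (bdryDist closedCuspᶜ b) :=
      le_min (by linarith) (by linarith)
    have h4 : dist a b ≤ 4 * t ^ 2 := by
      refine (dist_le_add_abs a b).trans_eq ?_
      change |t - t| + |2 * t ^ 2 - -(2 * t ^ 2)| = _
      rw [sub_self, abs_zero, zero_add, abs_of_nonneg (by nlinarith)]
      ring
    linarith
  have hψ := h.strictMono.monotone hratio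
  have hcontra : ENNReal.ofReal (M + 1) ≤ (ψ 12 : ℝ≥0∞) :=
    hlow.trans (hup.trans (ENNReal.coe_le_coe.2 hψ))
  rw [← ENNReal.ofReal_coe_nnreal, ← hM, ENNReal.ofReal_le_ofReal_iff hM0] at hcontra
  linarith

end Exterior

end PhiUniform

theorem mainTheorem3 :
    ∃ D : Set (EuclideanSpace ℝ (Fin 2)),
      PhiUniform.IsBoundedJordanDomain D ∧
      (∃ φ : ℝ≥0 ≃ₜ ℝ≥0, PhiUniform.IsPhiUniform φ D) ∧
      PhiUniform.IsOpenDomain (closure D)ᶜ ∧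
      (∀ ψ : ℝ≥0 ≃ₜ ℝ≥0, StrictMono ψ → ψ 0 = 0 →
        ¬ PhiUniform.IsPhiUniform ψ (closure D)ᶜ) := by
  refine ⟨PhiUniform.cuspDomain, PhiUniform.isBoundedJordanDomain_cuspDomain,
    ⟨_, PhiUniform.isPhiUniform_cuspDomain⟩, ?_⟩
  rw [PhiUniform.closure_cuspDomain]
  exact ⟨PhiUniform.isOpenDomain_compl_closedCusp,
    fun ψ _ _ => PhiUniform.not_isPhiUniform_compl_closedCusp ψ⟩
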